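/- Let $F$ be a finite field with $q$ elements, of odd characteristic, let $E$ be its quadratic extension, with norm $N$ and trace $\mathrm{Tr}$ from $E$ to $F$, and put $G=\mathrm{GL}(2,F)$. Fix an $F$-basis $(b_0,b_1)$ of $E$ with $\mathrm{Tr}(b_1/b_0)=0$ (for instance $(1,\sqrt t)$ with $t\in F^\times$ a non-square), let $m_z\in G$ be the matrix of $w\mapsto zw$ in this basis, and let $K=\{m_z: z\in E^\times\}$ be the Coxeter torus. A character $\Phi$ of $E^\times$ is also viewed as the character $m_z\mapsto\Phi(z)$ of $K$. Let $\Phi,\Lambda$ be complex characters of $E^\times$ with $\Lambda^q\ne\Lambda$, and let $\phi,\lambda$ be their restrictions to $F^\times$. Let $\chi^{q-1}_\Lambda$ be the character of the irreducible cuspidal representation of $G$ of dimension $q-1$ attached to $\Lambda$ (realized on the complex functions on $F^\times$ by its Kirillov model with respect to any nontrivial additive character $\psi$ of $F$). Define the twisted spherical function associated to $\chi^{q-1}_\Lambda$ by $$\zeta^\Phi_\Lambda(g)=\frac1{|K|}\sum_{k\in K}\Phi^{-1}(k)\,\chi^{q-1}_\Lambda(kg)\qquad(g\in G).$$ For $a\in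 F^\times$ let $d(a,1)=\begin{pmatrix}a&0\\0&1\end{pmatrix}$, let $$\Gamma_a=\{(z,w)\in E^\times\times E^\times:\ N(w)=a\,N(z),\ \mathrm{Tr}(w)=2^{-1}(a+1)\,\mathrm{Tr}(z)\},$$ and put $$S^\Phi_\Lambda(a)=-(q^2-1)^{-1}\sum_{(z,w)\in\Gamma_a}\Phi^{-1}(z)\Lambda(w).$$ Then $\zeta^\Phi_\Lambda(kgk')=\Phi(k)\,\zeta^\Phi_\Lambda(g)\,\Phi(k')$ for all $g\in G$ and $k,k'\in K$, so that on each double coset $K\,d(a,1)\,K$ the function is determined by its value at the representative $d(a,1)$, and for every $a\in F^\times$ $$\zeta^\Phi_\Lambda(d(a,1))=S^\Phi_\Lambda(a)+q(q+1)^{-1}\,\delta_{a,1}\,\delta_{\lambda,\phi},$$ where $\delta_{a,1}$ is $1$ if $a=1$ and $0$ otherwise, and $\delta_{\lambda,\phi}$ is $1$ if $\lambda=\phi$ and $0$ otherwise. -/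

import Mathlib

namespace TwistedSpherical

section QuadraticExtension

variable {F E : Type*} [Field F] [Fintype F] [Field E] [Fintype E] [Algebra F E]

theorem algebraMap_norm_eq (hE : Module.finrank F E = 2) (x : E) :
    algebraMap F E (Algebra.norm F x) = x * FiniteField.frobeniusAlgHom F E x := by
  rw [FiniteField.algebraMap_norm_eq_prod_pow, hE]
  simp [Finset.prod_range_succ]

theorem algebraMap_trace_eq (hE : Module.finrank F E = 2) (x : E) :
    algebraMap F E (Algebra.trace F E x) = x + FiniteField.frobeniusAlgHom F E x := by
  rw [FiniteField.algebraMap_trace_eq_sum_pow, hE]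
  simp [Finset.sum_range_succ]

theorem card_quadratic (hE : Module.finrank F E = 2) :
    Fintype.card E = Fintype.card F ^ 2 := by
  rw [← hE]; exact Module.card_eq_pow_finrank

theorem conj_conj (hE : Module.finrank F E = 2) (x : E) :
    FiniteField.frobeniusAlgHom F E (FiniteField.frobeniusAlgHom F E x) = x := by
  simp only [FiniteField.coe_frobeniusAlgHom]
  rw [← pow_mul, ← sq, ← card_quadratic hE, FiniteField.pow_card]

theorem sum_eq_zero_add_units {K : Type*} [Field K] [Fintype K] [Fintype Kˣ] (f : K → ℂ) :
    ∑ s, f s = f 0 + ∑ s : Kˣ, f s := by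
  classical
  rw [Fintype.sum_eq_add_sum_subtype_ne f 0]
  congr 1
  exact (Fintype.sum_equiv unitsEquivNeZero (fun s : Kˣ => f s) (fun s => f s.1)
    (fun _ => rfl)).symm

/-- Linear exponential sums over the quadratic extension. -/
theorem sum_trace (hE : Module.finrank F E = 2) {ψ : AddChar F ℂ} (hψ : ψ ≠ 1)
    [DecidableEq E] (β : E) :
    ∑ s : E, ψ (-Algebra.trace F E (s * FiniteField.frobeniusAlgHom F E β)) =
      if β = 0 then (Fintype.card F : ℂ) ^ 2 else 0 := by
  split_ifs with h
  · simp [h, card_quadratic hE]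
  · let χ : AddChar E ℂ := ψ.compAddMonoidHom (-((Algebra.trace F E).toAddMonoidHom.comp
      (AddMonoidHom.mulRight (FiniteField.frobeniusAlgHom F E β))))
    have hχ : χ ≠ 1 := by
      obtain ⟨x, hx⟩ := AddChar.ne_one_iff.1 hψ
      obtain ⟨y, hy⟩ := Algebra.trace_surjective F E (-x)
      have hβ : FiniteField.frobeniusAlgHom F E β ≠ 0 := by simpa using h
      refine AddChar.ne_one_iff.2 ⟨y / FiniteField.frobeniusAlgHom F E β, ?_⟩
      simp only [χ, AddChar.compAddMonoidHom_apply, AddMonoidHom.neg_apply,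
        AddMonoidHom.comp_apply, AddMonoidHom.coe_mulRight]
      rw [div_mul_cancel₀ _ hβ]
      simpa [hy] using hx
    exact AddChar.sum_eq_zero_of_ne_one hχ

/-- The exponential sum of the norm form over the quadratic extension. -/
theorem sum_norm (hE : Module.finrank F E = 2) {ψ : AddChar F ℂ} (hψ : ψ ≠ 1) {A : F}
    (hA : A ≠ 0) :
    ∑ s : E, ψ (A * Algebra.norm F s) = -(Fintype.card F : ℂ) := by
  classical
  rw [sum_eq_zero_add_units]
  let N : Eˣ →* Fˣ := Units.map (Algebra.norm F)
  have hN : Function.Surjective N := FiniteField.unitsMap_norm_surjective F E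
  have hq : 1 < Fintype.card F := Fintype.one_lt_card
  have hfib : ∀ y : Fˣ, (Finset.univ.filter fun s : Eˣ => N s = y).card
      = Fintype.card F + 1 := by
    have hsame : ∀ y : Fˣ, (Finset.univ.filter fun s : Eˣ => N s = y).card =
        (Finset.univ.filter fun s : Eˣ => N s = 1).card := fun y =>
      MonoidHom.card_fiber_eq_of_mem_range N (hN y) (hN 1)
    have htot : Fintype.card Eˣ = ∑ y : Fˣ, (Finset.univ.filter fun s : Eˣ => N s = y).card :=
      Finset.card_eq_sum_card_fiberwise (fun _ _ => Finset.mem_univ _)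
    simp_rw [hsame] at htot
    rw [Finset.sum_const, smul_eq_mul, Finset.card_univ, Fintype.card_units,
      Fintype.card_units, card_quadratic hE] at htot
    have h2 : Fintype.card F ^ 2 - 1 = (Fintype.card F - 1) * (Fintype.card F + 1) := by
      have := Nat.sq_sub_sq (Fintype.card F) 1
      rw [one_pow] at this
      rw [this, mul_comm]
    rw [h2] at htot
    intro y
    rw [hsame y]
    exact (Nat.eq_of_mul_eq_mul_left (by omega) htot).symm
  have h1 : ∑ s : Eˣ, ψ (A * Algebra.norm F (s : E)) =
      ∑ y : Fˣ, ((Fintype.card F : ℂ) + 1) * ψ (A * y) := by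
    rw [← Finset.sum_fiberwise (s := Finset.univ) (g := N)]
    refine Finset.sum_congr rfl fun y _ => ?_
    rw [Finset.sum_congr rfl (g := fun _ => ψ (A * y))]
    · rw [Finset.sum_const, hfib y]; simp
    · intro s hs
      rw [← (Finset.mem_filter.1 hs).2]; rfl
  have h2 : ∑ y : F, ψ (A * y) = 0 := by
    have := AddChar.sum_mulShift (ψ := ψ) A (AddChar.IsPrimitive.of_ne_one hψ)
    simpa [hA, mul_comm] using this
  rw [sum_eq_zero_add_units] at h2
  rw [h1, ← Finset.mul_sum]
  simp only [mul_zero, AddChar.map_zero_eq_one, Algebra.norm_zero] at h2 ⊢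
  linear_combination ((Fintype.card F : ℂ) + 1) * h2

/-- Quadratic exponential sums over the quadratic extension, by completing the square. -/
theorem sum_quadratic (hE : Module.finrank F E = 2) {ψ : AddChar F ℂ} (hψ : ψ ≠ 1) {A : F}
    (hA : A ≠ 0) (β : E) :
    ∑ s : E, ψ (A * Algebra.norm F s
        - Algebra.trace F E (s * FiniteField.frobeniusAlgHom F E β)) =
      -(Fintype.card F : ℂ) * ψ (-(Algebra.norm F β / A)) := by
  have key : ∀ s : E, A * Algebra.norm F s
      - Algebra.trace F E (s * FiniteField.frobeniusAlgHom F E β) =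
      A * Algebra.norm F (s - β / algebraMap F E A) + -(Algebra.norm F β / A) := by
    intro s
    apply (algebraMap F E).injective
    have hA' : algebraMap F E A ≠ 0 := by simpa using hA
    simp only [map_sub, map_mul, map_add, map_neg, map_div₀, algebraMap_norm_eq hE,
      algebraMap_trace_eq hE, conj_conj hE, AlgHom.commutes]
    field_simp
    ring
  simp_rw [key, AddChar.map_add_eq_mul]
  rw [← Finset.sum_mul]
  congr 1
  rw [← sum_norm hE hψ hA]
  exact Fintype.sum_equiv (Equiv.subRight (β / algebraMap F E A)) _ _ fun _ => rfl

/-- A character that differs from its Frobenius twist sums to zero over each norm fibre. -/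
theorem sum_norm_fibre {Λ : MulChar E ℂ}
    (hΛ : Λ ^ Fintype.card F ≠ Λ) [DecidableEq F] [Fintype Eˣ] (n : Fˣ) :
    ∑ t : Eˣ, (if Units.map (Algebra.norm F) t = n then Λ t else 0) = 0 := by
  classical
  obtain ⟨v, hv⟩ : ∃ v : Eˣ, Λ (v : E) ^ Fintype.card F ≠ Λ (v : E) := by
    by_contra! h
    exact hΛ (MulChar.ext fun v => by rw [MulChar.pow_apply_coe]; exact h v)
  let u : Eˣ := v ^ Fintype.card F * v⁻¹
  have hNu : Units.map (Algebra.norm F) u = 1 := by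
    have : ∀ y : Fˣ, y ^ Fintype.card F = y := fun y => Units.ext (by simp [FiniteField.pow_card])
    simp only [u, map_mul, map_pow, map_inv, this, mul_inv_cancel]
  have hv0 : Λ (v : E) ≠ 0 := (v.isUnit.map Λ).ne_zero
  have hΛu : Λ (u : E) ≠ 1 := by
    intro h
    apply hv
    have : u * v = v ^ Fintype.card F := by simp [u]
    have := congrArg (fun z : Eˣ => Λ (z : E)) this
    simpa [h] using this.symm
  refine eq_zero_of_mul_eq_self_left hΛu ?_
  rw [Finset.mul_sum]
  refine Fintype.sum_equiv (Equiv.mulLeft u) _ _ fun t => ?_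
  simp only [Equiv.coe_mulLeft, map_mul, hNu, one_mul, Units.val_mul, mul_ite, mul_zero]

end QuadraticExtension

section CuspidalRepresentation

variable {F E : Type*} [Field F] [Fintype F] [Field E] [Fintype E] [Algebra F E]

open Classical in
/-- The sum of `ψ(-Tr(t)/c) Λ(t)` over all `t` in `Eˣ` of norm `n`. -/
noncomputable def normFibreSum (ψ : AddChar F ℂ) (Λ : MulChar E ℂ) (c : F) (n : Fˣ) : ℂ :=
  ∑ t : Eˣ, if Units.map (Algebra.norm F) t = n then
    ψ (-(Algebra.trace F E t / c)) * Λ t else 0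

open Classical in
/-- The kernel `k(x, y)` of the operator by which the matrix with rows `(a, b)`, `(c, d)` and
determinant `D` acts in the Kirillov model of the cuspidal representation attached to `Λ`:
for `c = 0` the operator is `f ↦ (x ↦ Λ(d) ψ(b x / d) f(a x / d))`, and for `c ≠ 0` its kernel is
`-q⁻¹ ψ((a x + d y) / c) Λ(y)⁻¹ ∑ ψ(-Tr(t) / c) Λ(t)`, summed over `t` in `Eˣ` with
`N(t) = x y D`. -/
noncomputable def cuspidalKernel (ψ : AddChar F ℂ) (Λ : MulChar E ℂ) (a b c d : F)
    (D x y : Fˣ) : ℂ :=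
  if c = 0 then
    if d * y = a * x then Λ (algebraMap F E d) * ψ (b * x / d) else 0
  else
    -(Fintype.card F : ℂ)⁻¹ * ψ ((a * x + d * y) / c) * (Λ (algebraMap F E y))⁻¹ *
      normFibreSum ψ Λ c (x * y * D)

theorem normFibreSum_scale (hE : Module.finrank F E = 2) (ψ : AddChar F ℂ) (Λ : MulChar E ℂ)
    (c : F) (n m u : Fˣ) (hm : m = u ^ 2 * n) :
    normFibreSum ψ Λ (u * c) m = Λ (algebraMap F E u) * normFibreSum ψ Λ c n := by
  classical
  subst hm
  unfold normFibreSum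
  rw [Finset.mul_sum]
  let w : Eˣ := Units.map (algebraMap F E) u
  have hNw : Units.map (Algebra.norm F) w = u ^ 2 := by
    apply Units.ext
    simp [w, Algebra.norm_algebraMap, hE]
  refine (Fintype.sum_equiv (Equiv.mulLeft w) _ _ fun t => ?_).symm
  have h1 : (Units.map (Algebra.norm F) (w * t) = u ^ 2 * n) ↔
      Units.map (Algebra.norm F) t = n := by rw [map_mul, hNw, mul_right_inj]
  have h2 : Algebra.trace F E ((w * t : Eˣ) : E) = u * Algebra.trace F E (t : E) := by
    have : ((w * t : Eˣ) : E) = (u : F) • (t : E) := by simp [w, Algebra.smul_def]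
    rw [this, map_smul, smul_eq_mul]
  have h3 : Λ ((w * t : Eˣ) : E) = Λ (algebraMap F E u) * Λ t := by
    rw [Units.val_mul, map_mul]; rfl
  simp only [Equiv.coe_mulLeft, h1, h2, h3, mul_div_mul_left _ _ u.ne_zero]
  split_ifs
  · ring
  · simp

theorem map_algebraMap_ne_zero (Λ : MulChar E ℂ) {a : F} (ha : a ≠ 0) :
    Λ (algebraMap F E a) ≠ 0 :=
  ((IsUnit.mk0 a ha).map (algebraMap F E) |>.map Λ).ne_zero

theorem cuspidalKernel_mul_of_left [Fintype Fˣ] (hE : Module.finrank F E = 2)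
    (ψ : AddChar F ℂ) (Λ : MulChar E ℂ)
    {a₁ b₁ d₁ a₂ b₂ c₂ d₂ : F} {D₁ D₂ : Fˣ} (h₁ : (D₁ : F) = a₁ * d₁)
    (h₂ : (D₂ : F) = a₂ * d₂ - b₂ * c₂) (x z : Fˣ) :
    ∑ y : Fˣ, cuspidalKernel ψ Λ a₁ b₁ 0 d₁ D₁ x y * cuspidalKernel ψ Λ a₂ b₂ c₂ d₂ D₂ y z =
      cuspidalKernel ψ Λ (a₁ * a₂ + b₁ * c₂) (a₁ * b₂ + b₁ * d₂) (d₁ * c₂) (d₁ * d₂)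
        (D₁ * D₂) x z := by
  classical
  have ha₁ : a₁ ≠ 0 := by rintro rfl; exact D₁.ne_zero (by simp [h₁])
  have hd₁ : d₁ ≠ 0 := by rintro rfl; exact D₁.ne_zero (by simp [h₁])
  obtain ⟨u, rfl⟩ : ∃ u : Fˣ, (u : F) = d₁ := ⟨Units.mk0 d₁ hd₁, rfl⟩
  obtain ⟨v, rfl⟩ : ∃ v : Fˣ, (v : F) = a₁ := ⟨Units.mk0 a₁ ha₁, rfl⟩
  have hD : D₁ = v * u := Units.ext h₁
  subst hD
  have hxy : ∀ y : Fˣ, (u : F) * y = v * x ↔ y = u⁻¹ * v * x := by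
    intro y
    rw [mul_assoc, eq_inv_mul_iff_mul_eq, Units.ext_iff]
    simp
  rw [Finset.sum_eq_single (u⁻¹ * v * x)]
  rotate_left
  · intro y _ hy
    have : ¬ ((u : F) * y = v * x) := fun h => hy ((hxy y).1 h)
    simp [cuspidalKernel, this]
  · intro h; exact absurd (Finset.mem_univ _) h
  have e1 : cuspidalKernel ψ Λ v b₁ 0 u (v * u) x (u⁻¹ * v * x) =
      Λ (algebraMap F E u) * ψ (b₁ * x / u) := by
    simp only [cuspidalKernel, if_true, if_pos ((hxy (u⁻¹ * v * x)).2 rfl)]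
  rw [e1]
  have hu := u.ne_zero
  have hx := x.ne_zero
  by_cases hc : c₂ = 0
  · subst hc
    have hd₂ : d₂ ≠ 0 := by rintro rfl; exact D₂.ne_zero (by simp [h₂])
    simp only [cuspidalKernel, mul_zero, add_zero, if_true, Units.val_mul,
      Units.val_inv_eq_inv_val]
    have : (d₂ * (z : F) = a₂ * ((u : F)⁻¹ * v * x)) ↔ (u * d₂ * z = v * a₂ * x) := by
      field_simp
    simp only [this]
    split_ifs with h
    · simp only [map_mul]
      have : (v * b₂ + b₁ * d₂) * (x : F) / (u * d₂) =
        b₁ * x / u + b₂ * ((u : F)⁻¹ * v * x) / d₂ := by field_simp; ring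
      rw [this, AddChar.map_add_eq_mul]; ring
    · simp
  · have hc' : (u : F) * c₂ ≠ 0 := mul_ne_zero hu hc
    simp only [cuspidalKernel, if_neg hc, if_neg hc']
    rw [normFibreSum_scale hE ψ Λ c₂ (u⁻¹ * v * x * z * D₂) (x * z * (v * u * D₂)) u
      (Units.ext (by simp; field_simp))]
    have : ((v * a₂ + b₁ * c₂) * (x : F) + u * d₂ * z) / (u * c₂) =
        b₁ * x / u + (a₂ * ((u⁻¹ * v * x : Fˣ) : F) + d₂ * z) / c₂ := by
      simp only [Units.val_mul, Units.val_inv_eq_inv_val]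
      field_simp
      ring
    rw [this, AddChar.map_add_eq_mul]
    ring

theorem cuspidalKernel_mul_of_right [Fintype Fˣ] (hE : Module.finrank F E = 2)
    (ψ : AddChar F ℂ) (Λ : MulChar E ℂ)
    {a₁ b₁ c₁ d₁ a₂ b₂ d₂ : F} {D₁ D₂ : Fˣ} (hc : c₁ ≠ 0)
    (h₂ : (D₂ : F) = a₂ * d₂) (x z : Fˣ) :
    ∑ y : Fˣ, cuspidalKernel ψ Λ a₁ b₁ c₁ d₁ D₁ x y * cuspidalKernel ψ Λ a₂ b₂ 0 d₂ D₂ y z =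
      cuspidalKernel ψ Λ (a₁ * a₂) (a₁ * b₂ + b₁ * d₂) (c₁ * a₂) (c₁ * b₂ + d₁ * d₂)
        (D₁ * D₂) x z := by
  classical
  have ha₁ : a₂ ≠ 0 := by rintro rfl; exact D₂.ne_zero (by simp [h₂])
  have hd₁ : d₂ ≠ 0 := by rintro rfl; exact D₂.ne_zero (by simp [h₂])
  obtain ⟨u, rfl⟩ : ∃ u : Fˣ, (u : F) = d₂ := ⟨Units.mk0 d₂ hd₁, rfl⟩
  obtain ⟨v, rfl⟩ : ∃ v : Fˣ, (v : F) = a₂ := ⟨Units.mk0 a₂ ha₁, rfl⟩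
  have hD : D₂ = v * u := Units.ext h₂
  subst hD
  have hxy : ∀ y : Fˣ, (u : F) * z = v * y ↔ y = v⁻¹ * u * z := by
    intro y
    rw [mul_assoc, eq_inv_mul_iff_mul_eq, Units.ext_iff]
    simp [eq_comm]
  rw [Finset.sum_eq_single (v⁻¹ * u * z)]
  rotate_left
  · intro y _ hy
    have : ¬ ((u : F) * z = v * y) := fun h => hy ((hxy y).1 h)
    simp [cuspidalKernel, this]
  · intro h; exact absurd (Finset.mem_univ _) h
  have hu := u.ne_zero
  have hv := v.ne_zero
  have hc' : c₁ * (v : F) ≠ 0 := mul_ne_zero hc hv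
  simp only [cuspidalKernel, if_true, if_pos ((hxy (v⁻¹ * u * z)).2 rfl), if_neg hc, if_neg hc']
  rw [mul_comm c₁ (v : F),
    normFibreSum_scale hE ψ Λ c₁ (x * (v⁻¹ * u * z) * D₁) (x * z * (D₁ * (v * u))) v
      (Units.ext (by simp; field_simp))]
  have : (a₁ * v * (x : F) + (c₁ * b₂ + d₁ * u) * z) / (v * c₁) =
      (a₁ * x + d₁ * ((v⁻¹ * u * z : Fˣ) : F)) / c₁ + b₂ * ((v⁻¹ * u * z : Fˣ) : F) / u := by
    simp only [Units.val_mul, Units.val_inv_eq_inv_val]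
    field_simp
    ring
  rw [this, AddChar.map_add_eq_mul]
  have hΛ : Λ (algebraMap F E ((v⁻¹ * u * z : Fˣ) : F)) * Λ (algebraMap F E v) =
      Λ (algebraMap F E u) * Λ (algebraMap F E z) := by
    rw [← map_mul, ← map_mul, ← map_mul, ← map_mul]
    congr 2
    simp only [Units.val_mul, Units.val_inv_eq_inv_val]
    field_simp
  have n1 := map_algebraMap_ne_zero Λ (v⁻¹ * u * z).ne_zero
  have n2 := map_algebraMap_ne_zero Λ z.ne_zero
  have hinv : (Λ (algebraMap F E ((v⁻¹ * u * z : Fˣ) : F)))⁻¹ * Λ (algebraMap F E u) =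
      Λ (algebraMap F E v) * (Λ (algebraMap F E z))⁻¹ := by
    field_simp
    linear_combination -hΛ
  linear_combination (-(Fintype.card F : ℂ)⁻¹ *
    ψ ((a₁ * x + d₁ * ((v⁻¹ * u * z : Fˣ) : F)) / c₁) *
    ψ (b₂ * ((v⁻¹ * u * z : Fˣ) : F) / u) *
    normFibreSum ψ Λ c₁ (x * (v⁻¹ * u * z) * D₁)) * hinv

open Classical in
theorem sum_normFibreSum_mul [Fintype Fˣ]
    (hE : Module.finrank F E = 2)
    (ψ : AddChar F ℂ) (Λ : MulChar E ℂ) (e c₁ c₂ : F) (D₁ D₂ x z : Fˣ) :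
    ∑ y : Fˣ, ψ (e * y) * (Λ (algebraMap F E y))⁻¹ *
        (normFibreSum ψ Λ c₁ (x * y * D₁) * normFibreSum ψ Λ c₂ (y * z * D₂)) =
      ∑ r : Eˣ, if Units.map (Algebra.norm F) r = x * z * (D₁ * D₂) then
        Λ r * ∑ s : Eˣ, ψ (e / (x * D₁) * Algebra.norm F (s : E) -
          Algebra.trace F E (s * FiniteField.frobeniusAlgHom F E
            (algebraMap F E c₁⁻¹ + r * algebraMap F E (c₂ * x * D₁)⁻¹))) else 0 := by
  classical
  have lhs : ∀ y : Fˣ, ψ (e * y) * (Λ (algebraMap F E y))⁻¹ *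
        (normFibreSum ψ Λ c₁ (x * y * D₁) * normFibreSum ψ Λ c₂ (y * z * D₂)) =
      ∑ s : Eˣ, if y = Units.map (Algebra.norm F) s * (x * D₁)⁻¹ then
        ψ (e * y) * (Λ (algebraMap F E y))⁻¹ * (ψ (-(Algebra.trace F E s / c₁)) * Λ s *
          normFibreSum ψ Λ c₂ (y * z * D₂)) else 0 := by
    intro y
    rw [normFibreSum, Finset.sum_mul, Finset.mul_sum]
    refine Finset.sum_congr rfl fun s _ => ?_
    have : (Units.map (Algebra.norm F) s = x * y * D₁) ↔
        y = Units.map (Algebra.norm F) s * (x * D₁)⁻¹ := by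
      rw [eq_mul_inv_iff_mul_eq, eq_comm, mul_right_comm, mul_comm (x * D₁) y]
    simp only [this]
    by_cases h : y = Units.map (Algebra.norm F) s * (x * D₁)⁻¹
    · simp only [if_pos h]
    · simp only [if_neg h, zero_mul, mul_zero]
  simp_rw [lhs]
  rw [Finset.sum_comm]
  simp only [Finset.sum_ite_eq', Finset.mem_univ, if_true]
  have rhs : (∑ r : Eˣ, if Units.map (Algebra.norm F) r = x * z * (D₁ * D₂) then
        Λ r * ∑ s : Eˣ, ψ (e / (x * D₁) * Algebra.norm F (s : E) -
          Algebra.trace F E (s * FiniteField.frobeniusAlgHom F E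
            (algebraMap F E c₁⁻¹ + r * algebraMap F E (c₂ * x * D₁)⁻¹))) else 0) =
      ∑ s : Eˣ, ∑ r : Eˣ, if Units.map (Algebra.norm F) r = x * z * (D₁ * D₂) then
        Λ r * ψ (e / (x * D₁) * Algebra.norm F (s : E) -
          Algebra.trace F E (s * FiniteField.frobeniusAlgHom F E
            (algebraMap F E c₁⁻¹ + r * algebraMap F E (c₂ * x * D₁)⁻¹))) else 0 := by
    rw [Finset.sum_comm]
    refine Finset.sum_congr rfl fun r _ => ?_
    split_ifs
    · rw [Finset.mul_sum]
    · simp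
  rw [rhs]
  refine Finset.sum_congr rfl fun s _ => ?_
  set y : Fˣ := Units.map (Algebra.norm F) s * (x * D₁)⁻¹ with hy
  have hNs : Units.map (Algebra.norm F) s = y * (x * D₁) := by
    rw [hy, inv_mul_cancel_right]
  have hNs' : Algebra.norm F (s : E) = y * (x * D₁) := congrArg Units.val hNs
  let w : Eˣ := Units.map (algebraMap F E) y * s⁻¹
  have hw : (w : E) = algebraMap F E y * (s : E)⁻¹ := by simp [w]
  have hNw : Units.map (Algebra.norm F) w = y * (x * D₁)⁻¹ := by
    have : Units.map (Algebra.norm F) (Units.map (algebraMap F E : F →* E) y) = y ^ 2 := by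
      apply Units.ext
      simp [Algebra.norm_algebraMap, hE]
    rw [map_mul, map_inv, this, hNs, mul_inv, sq, mul_assoc, mul_inv_cancel_left]
  rw [normFibreSum, Finset.mul_sum, Finset.mul_sum]
  refine (Fintype.sum_equiv (Equiv.mulLeft w) _ _ fun r => ?_).symm
  have hcond : (Units.map (Algebra.norm F) (w * r) = y * z * D₂) ↔
      (Units.map (Algebra.norm F) r = x * z * (D₁ * D₂)) := by
    rw [map_mul, hNw, mul_assoc y, mul_assoc y, mul_right_inj, inv_mul_eq_iff_eq_mul]
    rw [show x * D₁ * (z * D₂) = x * z * (D₁ * D₂) from mul_mul_mul_comm _ _ _ _]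
  simp only [Equiv.coe_mulLeft, hcond]
  by_cases h : Units.map (Algebra.norm F) r = x * z * (D₁ * D₂)
  swap
  · simp only [if_neg h, mul_zero]
  simp only [if_pos h]
  have hs0 : (s : E) ≠ 0 := s.ne_zero
  have hΛs : Λ (s : E) ≠ 0 := (s.isUnit.map Λ).ne_zero
  have hΛy := map_algebraMap_ne_zero (E := E) Λ y.ne_zero
  have hΛw : Λ ((w * r : Eˣ) : E) * Λ (s : E) = Λ (algebraMap F E y) * Λ (r : E) := by
    rw [← map_mul, ← map_mul, Units.val_mul, hw]
    congr 1
    field_simp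
  have hexp : e / (x * D₁) * Algebra.norm F (s : E) -
          Algebra.trace F E (s * FiniteField.frobeniusAlgHom F E
            (algebraMap F E c₁⁻¹ + r * algebraMap F E (c₂ * x * D₁)⁻¹)) =
      e * y + (-(Algebra.trace F E (s : E) / c₁) +
        -(Algebra.trace F E ((w * r : Eˣ) : E) / c₂)) := by
    have hx := x.ne_zero
    have hD := D₁.ne_zero
    have h1 : e / (x * D₁) * Algebra.norm F (s : E) = e * y := by
      rw [hNs']; field_simp
    have h2 : Algebra.trace F E (s * FiniteField.frobeniusAlgHom F E
            (algebraMap F E c₁⁻¹ + r * algebraMap F E (c₂ * x * D₁)⁻¹)) =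
        Algebra.trace F E (s : E) / c₁ + Algebra.trace F E ((w * r : Eˣ) : E) / c₂ := by
      apply (algebraMap F E).injective
      have hyE : algebraMap F E y = s * FiniteField.frobeniusAlgHom F E s *
          (algebraMap F E (x * D₁))⁻¹ := by
        rw [← algebraMap_norm_eq hE, hNs', map_mul, mul_assoc, mul_inv_cancel₀, mul_one]
        simp
      have hwr : ((w * r : Eˣ) : E) = FiniteField.frobeniusAlgHom F E s * r *
          (algebraMap F E (x * D₁))⁻¹ := by
        rw [Units.val_mul, hw, hyE]
        field_simp
      rw [hwr]
      simp only [map_mul, map_add, map_div₀, map_inv₀,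
        algebraMap_trace_eq hE, conj_conj hE, AlgHom.commutes]
      field_simp
      ring
    rw [h1, h2]; ring
  rw [hexp, AddChar.map_add_eq_mul, AddChar.map_add_eq_mul]
  have : Λ (r : E) = (Λ (algebraMap F E y))⁻¹ * (Λ ((w * r : Eˣ) : E) * Λ (s : E)) := by
    rw [hΛw, inv_mul_cancel_left₀ hΛy]
  rw [this]
  ring

theorem cuspidalKernel_mul_of_ne_zero [Fintype Fˣ] (hE : Module.finrank F E = 2)
    {ψ : AddChar F ℂ} (hψ : ψ ≠ 1) {Λ : MulChar E ℂ} (hΛ : Λ ^ Fintype.card F ≠ Λ)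
    {a₁ b₁ c₁ d₁ a₂ b₂ c₂ d₂ : F} {D₁ D₂ : Fˣ} (hc₁ : c₁ ≠ 0) (hc₂ : c₂ ≠ 0)
    (h₁ : (D₁ : F) = a₁ * d₁ - b₁ * c₁) (h₂ : (D₂ : F) = a₂ * d₂ - b₂ * c₂) (x z : Fˣ) :
    ∑ y : Fˣ, cuspidalKernel ψ Λ a₁ b₁ c₁ d₁ D₁ x y *
        cuspidalKernel ψ Λ a₂ b₂ c₂ d₂ D₂ y z =
      cuspidalKernel ψ Λ (a₁ * a₂ + b₁ * c₂) (a₁ * b₂ + b₁ * d₂) (c₁ * a₂ + d₁ * c₂)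
        (c₁ * b₂ + d₁ * d₂) (D₁ * D₂) x z := by
  classical
  set q : ℂ := (Fintype.card F : ℂ) with hq
  have hq0 : q ≠ 0 := by simp [hq]
  set e : F := d₁ / c₁ + a₂ / c₂ with he
  have hx := x.ne_zero
  have hz := z.ne_zero
  have hD₁ := D₁.ne_zero
  have hD₂ := D₂.ne_zero
  have step1 : ∑ y : Fˣ, cuspidalKernel ψ Λ a₁ b₁ c₁ d₁ D₁ x y *
        cuspidalKernel ψ Λ a₂ b₂ c₂ d₂ D₂ y z =
      q⁻¹ ^ 2 * ψ (a₁ * x / c₁ + d₂ * z / c₂) * (Λ (algebraMap F E z))⁻¹ *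
      ∑ y : Fˣ, ψ (e * y) * (Λ (algebraMap F E y))⁻¹ *
        (normFibreSum ψ Λ c₁ (x * y * D₁) * normFibreSum ψ Λ c₂ (y * z * D₂)) := by
    rw [Finset.mul_sum]
    refine Finset.sum_congr rfl fun y _ => ?_
    simp only [cuspidalKernel, if_neg hc₁, if_neg hc₂]
    have : ψ ((a₁ * x + d₁ * y) / c₁) * ψ ((a₂ * y + d₂ * z) / c₂) =
        ψ (a₁ * x / c₁ + d₂ * z / c₂) * ψ (e * y) := by
      rw [← AddChar.map_add_eq_mul, ← AddChar.map_add_eq_mul]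
      congr 1
      rw [he]; ring
    linear_combination (q⁻¹ ^ 2 * (Λ (algebraMap F E y))⁻¹ * (Λ (algebraMap F E z))⁻¹ *
      normFibreSum ψ Λ c₁ (x * y * D₁) * normFibreSum ψ Λ c₂ (y * z * D₂)) * this
  rw [step1, sum_normFibreSum_mul hE]
  set n : Fˣ := x * z * (D₁ * D₂) with hn
  let β : E → E := fun r => algebraMap F E c₁⁻¹ + r * algebraMap F E (c₂ * x * D₁)⁻¹
  -- extend the inner sum to all of `E`
  have step2 : (∑ r : Eˣ, if Units.map (Algebra.norm F) r = n then
        Λ r * ∑ s : Eˣ, ψ (e / (x * D₁) * Algebra.norm F (s : E) -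
          Algebra.trace F E (s * FiniteField.frobeniusAlgHom F E (β r))) else 0) =
      ∑ r : Eˣ, if Units.map (Algebra.norm F) r = n then
        Λ r * ∑ s : E, ψ (e / (x * D₁) * Algebra.norm F (s : E) -
          Algebra.trace F E (s * FiniteField.frobeniusAlgHom F E (β r))) else 0 := by
    rw [← sub_eq_zero, ← Finset.sum_sub_distrib, ← neg_eq_zero, ← Finset.sum_neg_distrib]
    rw [← sum_norm_fibre hΛ n]
    refine Finset.sum_congr rfl fun r _ => ?_
    split_ifs
    · rw [sum_eq_zero_add_units (K := E)]
      simp only [Algebra.norm_zero, zero_mul, mul_zero, map_zero, sub_zero,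
        AddChar.map_zero_eq_one]
      ring
    · simp
  rw [step2]
  set c₃ := c₁ * a₂ + d₁ * c₂ with hc₃
  have hee : e = c₃ / (c₁ * c₂) := by rw [he, hc₃]; field_simp; ring
  by_cases h3 : c₃ = 0
  · have he0 : e = 0 := by rw [hee, h3, zero_div]
    simp only [cuspidalKernel, if_pos h3, he0, zero_div, zero_mul, zero_sub, sum_trace hE hψ]
    let r₀ : F := -(c₂ * x * D₁ / c₁)
    have hr₀ : r₀ ≠ 0 := by
      simp only [r₀, ne_eq, neg_eq_zero, div_eq_zero_iff, mul_eq_zero]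
      tauto
    let R : Eˣ := Units.map (algebraMap F E) (Units.mk0 r₀ hr₀)
    have hR : (R : E) = algebraMap F E r₀ := rfl
    have hβ : ∀ r : Eˣ, β r = 0 ↔ r = R := by
      intro r
      have hC : algebraMap F E (c₂ * x * D₁) ≠ 0 := by simp [hc₂]
      have hc₁' : algebraMap F E c₁ ≠ 0 := by simpa using hc₁
      rw [Units.ext_iff, hR]
      simp only [β, r₀, map_neg, map_div₀, map_inv₀]
      constructor
      · intro h
        field_simp at h ⊢
        linear_combination h
      · intro h
        rw [h]
        field_simp
        ring
    have hNR : (Units.map (Algebra.norm F) R = n) ↔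
        ((c₁ * b₂ + d₁ * d₂) * (z : F) = (a₁ * a₂ + b₁ * c₂) * x) := by
      have : Algebra.norm F (R : E) = r₀ ^ 2 := by
        rw [hR, Algebra.norm_algebraMap, hE]
      rw [Units.ext_iff, Units.coe_map]
      change Algebra.norm F (R : E) = (n : F) ↔ _
      rw [this]
      simp only [hn, Units.val_mul, r₀]
      have e1 : c₁ * (c₁ * b₂ + d₁ * d₂) * c₂ = -(c₁ ^ 2 * (D₂ : F)) := by
        rw [h₂]; linear_combination d₂ * c₁ * h3
      have e2 : c₁ * (a₁ * a₂ + b₁ * c₂) = - c₂ * (D₁ : F) := by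
        rw [h₁]; linear_combination a₁ * h3
      have hcc : c₁ * c₂ ≠ 0 := mul_ne_zero hc₁ hc₂
      rw [neg_sq, div_pow, div_eq_iff (pow_ne_zero 2 hc₁)]
      constructor
      · intro h
        have h' : c₂ ^ 2 * x * D₁ = z * D₂ * c₁ ^ 2 := by
          apply mul_left_cancel₀ (mul_ne_zero hx hD₁)
          linear_combination h
        apply mul_left_cancel₀ hcc
        linear_combination z * e1 - c₂ * x * e2 + h'
      · intro h
        linear_combination (x * D₁) * (c₂ * x * e2 - z * e1 + c₁ * c₂ * h)
    rw [Finset.sum_eq_single R]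
    rotate_left
    · intro r _ hr
      rw [if_neg (fun h => hr ((hβ r).1 h))]
      simp
    · intro h; exact absurd (Finset.mem_univ _) h
    rw [if_pos ((hβ R).2 rfl)]
    simp only [hNR]
    split_ifs with h
    swap
    · simp
    have hd₃ : c₁ * (c₁ * b₂ + d₁ * d₂) * c₂ = -(c₁ ^ 2 * (D₂ : F)) := by
      rw [h₂]; linear_combination d₂ * c₁ * h3
    have hd₃' : c₂ * (c₁ * b₂ + d₁ * d₂) = -(c₁ * (D₂ : F)) := by
      apply mul_left_cancel₀ hc₁; linear_combination hd₃
    have ha₃ : c₁ * (a₁ * a₂ + b₁ * c₂) = - c₂ * (D₁ : F) := by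
      rw [h₁]; linear_combination a₁ * h3
    have hd₃0 : c₁ * b₂ + d₁ * d₂ ≠ 0 := by
      intro h0
      rw [h0, mul_zero] at hd₃'
      exact mul_ne_zero hc₁ hD₂ (by linear_combination hd₃')
    have hRΛ : Λ (R : E) = Λ (algebraMap F E (c₁ * b₂ + d₁ * d₂)) * Λ (algebraMap F E z) := by
      rw [hR, ← map_mul, ← map_mul, h]
      congr 2
      simp only [r₀]
      field_simp
      linear_combination -ha₃
    have hψe : a₁ * x / c₁ + d₂ * z / c₂ =
        (a₁ * b₂ + b₁ * d₂) * x / (c₁ * b₂ + d₁ * d₂) := by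
      rw [eq_div_iff hd₃0, div_add_div _ _ hc₁ hc₂, div_mul_eq_mul_div,
        div_eq_iff (mul_ne_zero hc₁ hc₂)]
      linear_combination c₁ * d₂ * h + d₂ * x * ha₃ - d₂ * x * c₂ * h₁
    have hΛz := map_algebraMap_ne_zero (E := E) Λ hz
    rw [hψe, hRΛ, ← hq]
    field_simp
  · have hA : e / (x * D₁ : F) ≠ 0 := by
      rw [hee]
      exact div_ne_zero (div_ne_zero h3 (mul_ne_zero hc₁ hc₂)) (mul_ne_zero hx hD₁)
    simp only [sum_quadratic hE hψ hA, cuspidalKernel, if_neg h3, normFibreSum, Finset.mul_sum,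
      ← hq, ← hn]
    refine Finset.sum_congr rfl fun r _ => ?_
    by_cases h : Units.map (Algebra.norm F) r = n
    swap
    · simp only [if_neg h, mul_zero]
    simp only [if_pos h]
    have hNr : Algebra.norm F (r : E) = x * z * (D₁ * D₂) := by
      have := congrArg Units.val h
      simpa [hn] using this
    have hNβ : Algebra.norm F (β r) = c₁⁻¹ ^ 2 +
        Algebra.trace F E (r : E) * c₁⁻¹ * (c₂ * x * D₁)⁻¹ +
          (x * z * (D₁ * D₂)) * (c₂ * x * D₁)⁻¹ ^ 2 := by
      rw [← hNr]
      apply (algebraMap F E).injective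
      simp only [β, map_mul, map_add, map_pow, algebraMap_norm_eq hE, algebraMap_trace_eq hE,
        AlgHom.commutes]
      ring
    have hexp : a₁ * x / c₁ + d₂ * z / c₂ + -(Algebra.norm F (β r) / (e / (x * D₁))) =
        ((a₁ * a₂ + b₁ * c₂) * x + (c₁ * b₂ + d₁ * d₂) * z) / c₃ +
          -(Algebra.trace F E (r : E) / c₃) := by
      rw [hNβ, hee]
      field_simp
      rw [h₁, h₂, hc₃]
      ring
    have hψψ : ψ (a₁ * x / c₁ + d₂ * z / c₂) * ψ (-(Algebra.norm F (β r) / (e / (x * D₁)))) =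
        ψ (((a₁ * a₂ + b₁ * c₂) * x + (c₁ * b₂ + d₁ * d₂) * z) / c₃) *
          ψ (-(Algebra.trace F E (r : E) / c₃)) := by
      rw [← AddChar.map_add_eq_mul, ← AddChar.map_add_eq_mul, hexp]
    have hqq : q⁻¹ ^ 2 * q = q⁻¹ := by field_simp
    linear_combination (-(q⁻¹ ^ 2 * q) * (Λ (algebraMap F E z))⁻¹ * Λ r) * hψψ -
      ψ (((a₁ * a₂ + b₁ * c₂) * x + (c₁ * b₂ + d₁ * d₂) * z) / c₃) *
          ψ (-(Algebra.trace F E (r : E) / c₃)) * (Λ (algebraMap F E z))⁻¹ * Λ r * hqq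

open Classical in
theorem cuspidalKernel_one (ψ : AddChar F ℂ) (Λ : MulChar E ℂ) :
    Matrix.of (cuspidalKernel ψ Λ 1 0 0 1 1) = 1 := by
  ext x y
  simp only [cuspidalKernel, Matrix.of_apply, Matrix.one_apply, if_true, one_mul, map_one,
    zero_mul, zero_div, AddChar.map_zero_eq_one, Units.val_inj, eq_comm (a := y)]

open Classical in
/-- The cuspidal representation of `GL₂(F)` attached to a character `Λ` of `Eˣ` with `Λ^q ≠ Λ`,
realized on the complex functions on `Fˣ` (Kirillov model with respect to a nontrivial additive
character `ψ` of `F`). Its dimension is `q - 1`, and its isomorphism class does not depend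
on `ψ`. -/
noncomputable def cuspidalRep (hE : Module.finrank F E = 2) (ψ : AddChar F ℂ) (hψ : ψ ≠ 1)
    (Λ : MulChar E ℂ) (hΛ : Λ ^ Fintype.card F ≠ Λ) :
    Representation ℂ (Matrix.GeneralLinearGroup (Fin 2) F) (Fˣ → ℂ) where
  toFun g := Matrix.toLin' (Matrix.of (cuspidalKernel ψ Λ (g 0 0) (g 0 1) (g 1 0) (g 1 1)
    (Matrix.GeneralLinearGroup.det g)))
  map_one' := by
    simp [cuspidalKernel_one]
    rfl
  map_mul' g h := by
    have hg : ((Matrix.GeneralLinearGroup.det g : Fˣ) : F) = g 0 0 * g 1 1 - g 0 1 * g 1 0 :=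
      Matrix.det_fin_two _
    have hh : ((Matrix.GeneralLinearGroup.det h : Fˣ) : F) = h 0 0 * h 1 1 - h 0 1 * h 1 0 :=
      Matrix.det_fin_two _
    rw [Module.End.mul_eq_comp, ← Matrix.toLin'_mul]
    congr 1
    ext x z
    rw [Matrix.mul_apply]
    simp only [Matrix.of_apply, Units.val_mul, Matrix.mul_apply, Fin.sum_univ_two, map_mul]
    symm
    by_cases h1 : g 1 0 = 0
    · rw [h1, cuspidalKernel_mul_of_left hE ψ Λ (by rw [hg, h1]; ring) hh]
      simp
    · by_cases h2 : h 1 0 = 0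
      · rw [h2, cuspidalKernel_mul_of_right hE ψ Λ h1 (by rw [hh, h2]; ring)]
        simp
      · exact cuspidalKernel_mul_of_ne_zero hE hψ hΛ h1 h2 hg hh x z

end CuspidalRepresentation

section Averaging

variable {G : Type*} [Group G]

/-- The weighted average `(P_Φ f)(g) = |K|⁻¹ ∑_{k ∈ K} Φ(k)⁻¹ f(k g)` of a function `f` on a finite
group `G` with respect to a one-dimensional representation `Φ` of a subgroup `K`. -/
noncomputable def twistedAverage [Finite G] (K : Subgroup G) (Φ : K →* ℂˣ) (f : G → ℂ)
    (g : G) : ℂ :=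
  (Nat.card K : ℂ)⁻¹ * ∑ᶠ k : K, ((Φ k : ℂˣ) : ℂ)⁻¹ * f (k * g)

end Averaging

section Torus

variable {F E : Type*} [Field F] [Field E] [Algebra F E]

/-- `z ↦ m_z`: the matrix, in the `F`-basis `b` of `E`, of the multiplication by `z`. -/
noncomputable def torusHom (b : Module.Basis (Fin 2) F E) :
    Eˣ →* Matrix.GeneralLinearGroup (Fin 2) F :=
  Units.map (Algebra.leftMulMatrix b : E →* Matrix (Fin 2) (Fin 2) F)

theorem torusHom_injective (b : Module.Basis (Fin 2) F E) :
    Function.Injective (torusHom b) :=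
  Units.map_injective (Algebra.leftMulMatrix_injective b)

/-- The Coxeter torus `K` of `GL₂(F)`: all matrices `m_z`, `z ∈ Eˣ`. -/
noncomputable def torus (b : Module.Basis (Fin 2) F E) :
    Subgroup (Matrix.GeneralLinearGroup (Fin 2) F) :=
  (torusHom b).range

/-- The isomorphism `z ↦ m_z` of `Eˣ` with the Coxeter torus. -/
noncomputable def torusEquiv (b : Module.Basis (Fin 2) F E) : Eˣ ≃* torus b :=
  MonoidHom.ofInjective (torusHom_injective b)

/-- A character of `Eˣ`, seen as a character of the Coxeter torus: `m_z ↦ Φ(z)`. -/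
noncomputable def torusChar (b : Module.Basis (Fin 2) F E) (Φ : MulChar E ℂ) :
    torus b →* ℂˣ :=
  Φ.toUnitHom.comp (torusEquiv b).symm.toMonoidHom

/-- The restriction to `Fˣ` of a character of `Eˣ`. -/
noncomputable def restrictToBase (F : Type*) {E : Type*} [Field F] [Field E] [Algebra F E]
    (Φ : MulChar E ℂ) : Fˣ →* ℂˣ :=
  Φ.toUnitHom.comp (Units.map (algebraMap F E))

/-- The diagonal matrix `d(a, 1)`. -/
noncomputable def diagOne (a : Fˣ) : Matrix.GeneralLinearGroup (Fin 2) F :=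
  Matrix.GeneralLinearGroup.mkOfDetNeZero !![(a : F), 0; 0, 1] (by simp)

/-- `Γ_a`: all pairs `(z, w)` in `Eˣ × Eˣ` with `N(w) = a N(z)` and
`Tr(w) = 2⁻¹ (a + 1) Tr(z)`. -/
def normTraceSet (E : Type*) [Field E] [Algebra F E] (a : Fˣ) : Set (Eˣ × Eˣ) :=
  {p | Algebra.norm F (p.2 : E) = a * Algebra.norm F (p.1 : E) ∧
    Algebra.trace F E (p.2 : E) = 2⁻¹ * (a + 1) * Algebra.trace F E (p.1 : E)}

/-- `S^Φ_Λ(a) = -(q² - 1)⁻¹ ∑_{(z, w) ∈ Γ_a} Φ⁻¹(z) Λ(w)`. -/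
noncomputable def twistedSum [Fintype F] (Φ Λ : MulChar E ℂ) (a : Fˣ) : ℂ :=
  -((Fintype.card F : ℂ) ^ 2 - 1)⁻¹ *
    ∑ᶠ p ∈ normTraceSet E a, (Φ (p.1 : E))⁻¹ * Λ (p.2 : E)

/-- The twisted spherical function `ζ^Φ_Λ = P_Φ(χ_Λ)` of `GL₂(F)`, where `χ_Λ` is the character
of the cuspidal representation attached to `Λ`. -/
noncomputable def twistedSpherical [Fintype F] [Fintype E] (hE : Module.finrank F E = 2)
    (b : Module.Basis (Fin 2) F E) (ψ : AddChar F ℂ) (hψ : ψ ≠ 1)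
    (Φ Λ : MulChar E ℂ) (hΛ : Λ ^ Fintype.card F ≠ Λ) :
    Matrix.GeneralLinearGroup (Fin 2) F → ℂ :=
  twistedAverage (torus b) (torusChar b Φ) (cuspidalRep hE ψ hψ Λ hΛ).character

end Torus

end TwistedSpherical

/-!
The trace of the Kirillov model shows that the cuspidal character of `Λ` is the sum of two class
functions: `q` times the extension by zero of `λ = Λ|_{Fˣ}` from the centre of `GL₂(F)`, and
`g ↦ -T(det g, tr g)`, where `T(n, t)` is the sum of `Λ` over the elements of `Eˣ` of norm `n` and
trace `t`. Since `Tr(b₁ / b₀) = 0`, both diagonal entries of `m_z` are `Tr(z) / 2`, so that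
`m_z d(a, 1)` has determinant `a N(z)` and trace `(a + 1) Tr(z) / 2`; hence the average of the
second function at `d(a, 1)` is the sum over `Γ_a`. On the other hand `m_z d(a, 1)` is central only
if `a = 1` and `z ∈ Fˣ`, and the orthogonality of the characters of `Fˣ` turns the average of the
first function into the correction term, with coefficient `q (q - 1) / (q² - 1) = q / (q + 1)`.
-/

namespace TwistedSpherical

open Matrix (GeneralLinearGroup)

section TwistedAverage

variable {G : Type*} [Group G] [Finite G] (K : Subgroup G) (Φ : K →* ℂˣ)

theorem twistedAverage_mul_left (f : G → ℂ) (k : K) (g : G) :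
    twistedAverage K Φ f (k * g) = Φ k * twistedAverage K Φ f g := by
  have hsum : ∑ᶠ h : K, (Φ h : ℂ)⁻¹ * f (h * (k * g)) =
      ∑ᶠ h : K, Φ k * ((Φ h : ℂ)⁻¹ * f (h * g)) := by
    refine finsum_eq_of_bijective (· * k) (Equiv.mulRight k).bijective fun h => ?_
    simp only [map_mul, Units.val_mul, Subgroup.coe_mul, mul_assoc]
    field_simp
  rw [twistedAverage, hsum, ← mul_finsum, mul_left_comm, twistedAverage]

theorem twistedAverage_mul_right {f : G → ℂ} (hf : ∀ (k : K) (g : G), f (g * k) = f (k * g))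
    (k : K) (g : G) :
    twistedAverage K Φ f (g * k) = twistedAverage K Φ f g * Φ k := by
  have hsum : ∑ᶠ h : K, (Φ h : ℂ)⁻¹ * f (h * (g * k)) =
      ∑ᶠ h : K, Φ k * ((Φ h : ℂ)⁻¹ * f (h * g)) := by
    refine finsum_eq_of_bijective (k * ·) (Equiv.mulLeft k).bijective fun h => ?_
    rw [← mul_assoc, hf, map_mul, Units.val_mul, Subgroup.coe_mul, mul_assoc]
    field_simp
  rw [twistedAverage, hsum, ← mul_finsum, mul_left_comm, mul_comm, twistedAverage]

theorem twistedAverage_mul_sub (c : ℂ) (f₁ f₂ : G → ℂ) (g : G) :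
    twistedAverage K Φ (fun x => c * f₁ x - f₂ x) g =
      c * twistedAverage K Φ f₁ g - twistedAverage K Φ f₂ g := by
  simp only [twistedAverage, mul_sub, mul_left_comm _ c]
  rw [finsum_sub_distrib (Set.toFinite _) (Set.toFinite _), ← mul_finsum, mul_sub, mul_left_comm]

end TwistedAverage

section CentralExtension

variable {n R : Type*} [DecidableEq n] [Fintype n] [CommRing R]

/-- The extension by zero to `GL n R` of a character of its centre, the group of scalar matrices,
which is identified with `Rˣ`. -/
noncomputable def centralExtension (χ : Rˣ →* ℂˣ) : GeneralLinearGroup n R → ℂ :=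
  Function.extend (GeneralLinearGroup.scalar n) (fun x => (χ x : ℂ)) 0

theorem centralExtension_scalar [Nonempty n] (χ : Rˣ →* ℂˣ) (x : Rˣ) :
    centralExtension χ (GeneralLinearGroup.scalar n x) = χ x :=
  (Units.map_injective fun _ _ => Matrix.scalar_inj.1).extend_apply _ _ x

theorem centralExtension_of_notMem_center (χ : Rˣ →* ℂˣ) {g : GeneralLinearGroup n R}
    (hg : g ∉ Subgroup.center (GeneralLinearGroup n R)) : centralExtension χ g = 0 :=
  Function.extend_apply' _ _ _ <| by
    rwa [GeneralLinearGroup.center_eq_range_scalar] at hg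

theorem mem_center_iff_fin_two {g : GeneralLinearGroup (Fin 2) R} :
    g ∈ Subgroup.center (GeneralLinearGroup (Fin 2) R) ↔
      g 1 0 = 0 ∧ g 0 1 = 0 ∧ g 0 0 = g 1 1 := by
  rw [GeneralLinearGroup.mem_center_iff_val_mem_range_scalar]
  constructor
  · rintro ⟨x, hx⟩
    simp [← hx]
  · rintro ⟨h10, h01, h⟩
    refine ⟨g 0 0, Matrix.ext fun i j => ?_⟩
    fin_cases i <;> fin_cases j <;> simp [h10, h01, h]

end CentralExtension

section CharacterSums

theorem sum_inv_mul_hom_units {G R : Type*} [Group G] [Fintype G] [CommRing R] [IsDomain R]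
    (χ η : G →* Rˣ) [Decidable (η = χ)] :
    ∑ g, (((χ g)⁻¹ * η g : Rˣ) : R) = if η = χ then (Fintype.card G : R) else 0 := by
  classical
  have htrivial : (Units.coeHom R).comp (χ⁻¹ * η) = 1 ↔ η = χ := by
    simp only [MonoidHom.ext_iff, MonoidHom.comp_apply, Units.coeHom_apply, MonoidHom.one_apply,
      Units.val_eq_one, MonoidHom.mul_apply, MonoidHom.inv_apply, inv_mul_eq_one,
      eq_comm (a := χ _)]
  simpa [htrivial] using sum_hom_units ((Units.coeHom R).comp (χ⁻¹ * η))

variable {F : Type*} [Field F] [Fintype F]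

theorem sum_units_addChar_mul [DecidableEq F] {ψ : AddChar F ℂ} (hψ : ψ ≠ 1) (e : F) :
    ∑ x : Fˣ, ψ (x * e) = (if e = 0 then (Fintype.card F : ℂ) else 0) - 1 := by
  have h := AddChar.sum_mulShift e (AddChar.IsPrimitive.of_ne_one hψ)
  rw [sum_eq_zero_add_units, zero_mul, AddChar.map_zero_eq_one, Nat.cast_ite, Nat.cast_zero] at h
  exact eq_sub_of_add_eq' h

end CharacterSums

section QuadraticExtension

theorem sq_sub_trace_mul_add_norm_eq_zero {R S : Type*} [CommRing R] [CommRing S] [Algebra R S]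
    (b : Module.Basis (Fin 2) R S) (s : S) :
    s ^ 2 - algebraMap R S (Algebra.trace R S s) * s + algebraMap R S (Algebra.norm R s) = 0 := by
  obtain _ | _ := subsingleton_or_nontrivial R
  · have := Module.subsingleton R S
    exact Subsingleton.elim _ _
  apply Algebra.leftMulMatrix_injective b
  simpa [Matrix.charpoly_fin_two, Algebra.trace_eq_matrix_trace b, Algebra.norm_eq_matrix_det b]
    using Matrix.aeval_self_charpoly (Algebra.leftMulMatrix b s)

variable {F E : Type*} [Field F] [Field E] [Algebra F E]

theorem norm_eq_mul_and_trace_eq_add_iff (hE : Module.finrank F E = 2) {a d : F} {s : E} :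
    Algebra.norm F s = a * d ∧ Algebra.trace F E s = a + d ↔ a = d ∧ s = algebraMap F E a := by
  constructor
  · rintro ⟨hnorm, htrace⟩
    have hroots : (s - algebraMap F E a) * (s - algebraMap F E d) = 0 := by
      have := Module.finite_of_finrank_eq_succ hE
      have hs := sq_sub_trace_mul_add_norm_eq_zero (Module.finBasisOfFinrankEq F E hE) s
      rw [hnorm, htrace, map_add, map_mul] at hs
      linear_combination hs
    obtain h | h := mul_eq_zero.1 hroots <;> obtain rfl := sub_eq_zero.1 h <;>
      rw [Algebra.trace_algebraMap, hE, two_smul] at htrace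
    · exact ⟨add_left_cancel htrace, rfl⟩
    · obtain rfl := add_right_cancel htrace
      exact ⟨rfl, rfl⟩
  · rintro ⟨rfl, rfl⟩
    rw [Algebra.norm_algebraMap, Algebra.trace_algebraMap, hE, two_smul, sq]
    exact ⟨rfl, rfl⟩

variable [Fintype E]

open scoped Classical in
/-- The sum of `Λ` over the elements of `Eˣ` of norm `n` and trace `t`. As a function of the
determinant and the trace of `g`, it is the negative of the cuspidal character at a non-central
`g`. -/
noncomputable def normTraceSum (Λ : MulChar E ℂ) (n : Fˣ) (t : F) : ℂ :=
  ∑ s : Eˣ with Units.map (Algebra.norm F) s = n ∧ Algebra.trace F E s = t, Λ s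

theorem normTraceSum_mul_add [DecidableEq F] (hE : Module.finrank F E = 2) (Λ : MulChar E ℂ)
    (a d : Fˣ) :
    normTraceSum Λ (a * d) (a + d : F) = if a = d then Λ (algebraMap F E a) else 0 := by
  classical
  have hroots (s : Eˣ) : (Units.map (Algebra.norm F) s = a * d ∧
      Algebra.trace F E s = a + d) ↔ a = d ∧ s = Units.map (algebraMap F E) a := by
    simpa [Units.ext_iff] using norm_eq_mul_and_trace_eq_add_iff hE (a := a) (d := d) (s := s)
  simp only [normTraceSum, hroots]
  split_ifs with h
  · simp [h, Finset.filter_eq']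
  · simp [h]

end QuadraticExtension

section CuspidalCharacter

variable {F E : Type*} [Field F] [Fintype F] [Field E] [Fintype E] [Algebra F E]

open scoped Classical in
theorem cuspidalKernel_diag_of_ne_zero (hE : Module.finrank F E = 2)
    (ψ : AddChar F ℂ) (Λ : MulChar E ℂ) (a b : F) {c : F} (hc : c ≠ 0) (d : F) (D x : Fˣ) :
    cuspidalKernel ψ Λ a b c d D x x =
      -(Fintype.card F : ℂ)⁻¹ * ∑ t : Eˣ with Units.map (Algebra.norm F) t = D,
        Λ t * ψ (x * ((a + d - Algebra.trace F E t) / c)) := by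
  have hx : (x : F) ≠ 0 := x.ne_zero
  have hΛx : Λ (algebraMap F E x) ≠ 0 := map_algebraMap_ne_zero Λ hx
  have hscale : normFibreSum ψ Λ c (x * x * D) =
      Λ (algebraMap F E x) * normFibreSum ψ Λ (c / x) D := by
    rw [← normFibreSum_scale hE ψ Λ _ _ (x * x * D) x (by rw [sq]), mul_div_cancel₀ c hx]
  have hψ (t : Eˣ) : ψ (x * ((a + d - Algebra.trace F E t) / c)) =
      ψ ((a * x + d * x) / c) * ψ (-(Algebra.trace F E t / (c / x))) := by
    rw [← AddChar.map_add_eq_mul]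
    congr 1
    field_simp
    ring
  rw [cuspidalKernel, if_neg hc, hscale, normFibreSum, ← Finset.sum_filter]
  simp only [hψ, mul_left_comm (Λ _) (ψ ((a * x + d * x) / c)), ← Finset.mul_sum,
    mul_comm (Λ _) (ψ (-_))]
  field_simp

open scoped Classical in
theorem sum_cuspidalKernel_diag_of_ne_zero (hE : Module.finrank F E = 2) {ψ : AddChar F ℂ}
    (hψ : ψ ≠ 1) {Λ : MulChar E ℂ} (hΛ : Λ ^ Fintype.card F ≠ Λ) (a b : F) {c : F} (hc : c ≠ 0)
    (d : F) (D : Fˣ) :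
    ∑ x : Fˣ, cuspidalKernel ψ Λ a b c d D x x = -normTraceSum Λ D (a + d) := by
  have hq : (Fintype.card F : ℂ) ≠ 0 := Nat.cast_ne_zero.2 Fintype.card_ne_zero
  have hdiff (t : Eˣ) : (a + d - Algebra.trace F E (t : E)) / c = 0 ↔
      Algebra.trace F E (t : E) = a + d := by
    rw [div_eq_zero_iff, or_iff_left hc, sub_eq_zero, eq_comm]
  have hfibre : ∑ t : Eˣ with Units.map (Algebra.norm F) t = D, Λ t = 0 := by
    rw [Finset.sum_filter]
    exact sum_norm_fibre hΛ D
  calc ∑ x : Fˣ, cuspidalKernel ψ Λ a b c d D x x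
    _ = -(Fintype.card F : ℂ)⁻¹ * ∑ t : Eˣ with Units.map (Algebra.norm F) t = D,
          Λ t * ∑ x : Fˣ, ψ (x * ((a + d - Algebra.trace F E (t : E)) / c)) := by
      simp only [cuspidalKernel_diag_of_ne_zero hE ψ Λ a b hc, Finset.mul_sum]
      exact Finset.sum_comm
    _ = -(Fintype.card F : ℂ)⁻¹ * ∑ t : Eˣ with Units.map (Algebra.norm F) t = D,
          Λ t * ((if Algebra.trace F E (t : E) = a + d then (Fintype.card F : ℂ) else 0) - 1) := by
      simp only [sum_units_addChar_mul hψ, hdiff]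
    _ = -(Fintype.card F : ℂ)⁻¹ * (normTraceSum Λ D (a + d) * Fintype.card F) := by
      simp only [mul_sub, mul_ite, mul_zero, mul_one, Finset.sum_sub_distrib, hfibre, sub_zero]
      rw [← Finset.sum_filter, Finset.filter_filter, ← Finset.sum_mul, normTraceSum]
    _ = -normTraceSum Λ D (a + d) := by field_simp

theorem sum_cuspidalKernel_diag_of_eq_zero [DecidableEq F] {ψ : AddChar F ℂ} (hψ : ψ ≠ 1)
    (Λ : MulChar E ℂ) (a d : Fˣ) (b : F) (D : Fˣ) :
    ∑ x : Fˣ, cuspidalKernel ψ Λ a b 0 d D x x =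
      if a = d then
        Λ (algebraMap F E a) * ((if b = 0 then (Fintype.card F : ℂ) else 0) - 1) else 0 := by
  have hdiag (x : Fˣ) : (d * x : F) = a * x ↔ a = d := by
    rw [mul_left_inj' x.ne_zero, Units.val_inj, eq_comm]
  simp only [cuspidalKernel, if_true, hdiag]
  obtain rfl | had := eq_or_ne a d
  · have hψ' (x : Fˣ) : ψ (b * x / a) = ψ (x * (b / a)) := by rw [mul_comm b, mul_div_assoc]
    have hba : b / a = 0 ↔ b = 0 := by rw [div_eq_zero_iff, or_iff_left a.ne_zero]
    simp only [hψ', if_true, ← Finset.mul_sum, sum_units_addChar_mul hψ, hba]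
  · simp only [had, if_false, Finset.sum_const_zero]

open scoped Classical in
theorem character_cuspidalRep_eq_sum (hE : Module.finrank F E = 2) {ψ : AddChar F ℂ} (hψ : ψ ≠ 1)
    {Λ : MulChar E ℂ} (hΛ : Λ ^ Fintype.card F ≠ Λ) (g : GeneralLinearGroup (Fin 2) F) :
    (cuspidalRep hE ψ hψ Λ hΛ).character g = ∑ x : Fˣ,
      cuspidalKernel ψ Λ (g 0 0) (g 0 1) (g 1 0) (g 1 1) (GeneralLinearGroup.det g) x x :=
  Matrix.trace_toLin'_eq _

theorem character_cuspidalRep (hE : Module.finrank F E = 2) {ψ : AddChar F ℂ} (hψ : ψ ≠ 1)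
    {Λ : MulChar E ℂ} (hΛ : Λ ^ Fintype.card F ≠ Λ) (g : GeneralLinearGroup (Fin 2) F) :
    (cuspidalRep hE ψ hψ Λ hΛ).character g =
      Fintype.card F * centralExtension (restrictToBase F Λ) g -
        normTraceSum Λ (GeneralLinearGroup.det g) (Matrix.trace g.val) := by
  classical
  rw [character_cuspidalRep_eq_sum, Matrix.trace_fin_two]
  by_cases hc : g 1 0 = 0
  · have hdet : (GeneralLinearGroup.det g : F) = g 0 0 * g 1 1 := by
      rw [GeneralLinearGroup.val_det_apply, Matrix.det_fin_two, hc, mul_zero, sub_zero]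
    have hunit : IsUnit (g 0 0 * g 1 1) := hdet ▸ (GeneralLinearGroup.det g).isUnit
    obtain ⟨a, ha⟩ := isUnit_of_mul_isUnit_left hunit
    obtain ⟨d, hd⟩ := isUnit_of_mul_isUnit_right hunit
    rw [← ha, ← hd, ← Units.val_mul, Units.val_inj] at hdet
    rw [← ha, ← hd, hc, hdet, sum_cuspidalKernel_diag_of_eq_zero hψ, normTraceSum_mul_add hE]
    by_cases hg : g ∈ Subgroup.center (GeneralLinearGroup (Fin 2) F)
    · rw [GeneralLinearGroup.center_eq_range_scalar] at hg
      obtain ⟨x, rfl⟩ := hg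
      obtain rfl : a = x := Units.ext ha
      obtain rfl : d = a := Units.ext hd
      have hb : GeneralLinearGroup.scalar (Fin 2) d 0 1 = 0 := rfl
      rw [centralExtension_scalar, if_pos rfl, if_pos hb, if_pos rfl, mul_sub, mul_one, mul_comm]
      rfl
    · rw [centralExtension_of_notMem_center _ hg, mul_zero, zero_sub]
      rw [mem_center_iff_fin_two, ← ha, ← hd, Units.val_inj] at hg
      split_ifs with had hb
      · exact absurd ⟨hc, hb, had⟩ hg
      · rw [zero_sub, mul_neg_one]
      · exact neg_zero.symm
  · rw [sum_cuspidalKernel_diag_of_ne_zero hE hψ hΛ _ _ hc,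
      centralExtension_of_notMem_center _ fun hg => hc (mem_center_iff_fin_two.1 hg).1,
      mul_zero, zero_sub]

end CuspidalCharacter

section TorusMatrices

variable {F E : Type*} [Field F] [Field E] [Algebra F E] (b : Module.Basis (Fin 2) F E)

theorem torusHom_map_algebraMap (x : Fˣ) :
    torusHom b (Units.map (algebraMap F E) x) = GeneralLinearGroup.scalar (Fin 2) x :=
  Units.ext ((Algebra.leftMulMatrix b).commutes (x : F))

theorem det_torusHom (z : Eˣ) :
    GeneralLinearGroup.det (torusHom b z) = Units.map (Algebra.norm F) z :=
  Units.ext (Algebra.norm_eq_matrix_det b (z : E)).symm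

theorem diagOne_one : diagOne (1 : Fˣ) = 1 :=
  Units.ext Matrix.one_fin_two.symm

theorem det_diagOne (a : Fˣ) : GeneralLinearGroup.det (diagOne a) = a :=
  Units.ext <| by simp [diagOne]

theorem torusHom_eq_diagOne_iff {z : Eˣ} {a : Fˣ} :
    torusHom b z = diagOne a ↔ z = 1 ∧ a = 1 := by
  constructor
  · intro h
    -- Both matrices fix the second basis vector, and `z * b 1 = b 1` forces `z = 1`.
    have hfix : (z : E) * b 1 = b 1 := b.ext_elem fun i => by
      rw [← Algebra.leftMulMatrix_eq_repr_mul, b.repr_self]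
      have hi : torusHom b z i 1 = diagOne a i 1 := by rw [h]
      fin_cases i <;> simpa [torusHom, diagOne] using hi
    obtain rfl : z = 1 := Units.ext (mul_eq_right₀ (b.ne_zero 1) |>.1 hfix)
    have ha : diagOne a 0 0 = 1 := by rw [← h, map_one]; rfl
    exact ⟨rfl, Units.ext ha⟩
  · rintro ⟨rfl, rfl⟩
    rw [map_one, diagOne_one]

theorem torusHom_mul_diagOne_mem_center_iff {z : Eˣ} {a : Fˣ} :
    torusHom b z * diagOne a ∈ Subgroup.center (GeneralLinearGroup (Fin 2) F) ↔
      a = 1 ∧ z ∈ (Units.map (algebraMap F E : F →* E)).range := by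
  have hscalar (x : Fˣ) : GeneralLinearGroup.scalar (Fin 2) x = torusHom b z * diagOne a ↔
      a = 1 ∧ Units.map (algebraMap F E) x = z := by
    rw [← torusHom_map_algebraMap b, ← inv_mul_eq_iff_eq_mul, ← map_inv, ← map_mul,
      torusHom_eq_diagOne_iff, inv_mul_eq_one, and_comm, eq_comm (a := z)]
  simp only [GeneralLinearGroup.center_eq_range_scalar, MonoidHom.mem_range, hscalar,
    exists_and_left]

theorem sum_inv_mul_centralExtension_torusHom [Fintype Eˣ] [Fintype Fˣ] [DecidableEq (Fˣ →* ℂˣ)]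
    (Φ : MulChar E ℂ) (χ : Fˣ →* ℂˣ) :
    ∑ z : Eˣ, (Φ z)⁻¹ * centralExtension χ (torusHom b z) =
      if χ = restrictToBase F Φ then (Fintype.card Fˣ : ℂ) else 0 := by
  rw [← sum_inv_mul_hom_units]
  refine (Fintype.sum_of_injective (Units.map (algebraMap F E : F →* E))
    (Units.map_injective (algebraMap F E).injective) _ _ (fun z hz => ?_) fun x => ?_).symm
  · rw [centralExtension_of_notMem_center, mul_zero]
    rw [← mul_one (torusHom b z), ← diagOne_one, torusHom_mul_diagOne_mem_center_iff]
    exact fun h => hz h.2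
  · rw [torusHom_map_algebraMap, centralExtension_scalar, Units.val_mul, Units.val_inv_eq_inv_val]
    rfl

variable {b}

theorem trace_eq_two_mul_leftMulMatrix_zero (hb : Algebra.trace F E (b 1 / b 0) = 0) (z : E) :
    Algebra.trace F E z = 2 * Algebra.leftMulMatrix b z 0 0 := by
  have hz : z = algebraMap F E (Algebra.leftMulMatrix b z 0 0) +
      Algebra.leftMulMatrix b z 1 0 • (b 1 / b 0) := by
    have hsum := b.sum_repr (z * b 0)
    simp only [Fin.sum_univ_two, ← Algebra.leftMulMatrix_eq_repr_mul, Algebra.smul_def] at hsum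
    rw [Algebra.smul_def, ← mul_div_assoc, ← mul_left_inj' (b.ne_zero 0), add_mul,
      div_mul_cancel₀ _ (b.ne_zero 0), hsum]
  conv_lhs => rw [hz]
  rw [map_add, map_smul, hb, smul_zero, add_zero, Algebra.trace_algebraMap,
    Module.finrank_eq_card_basis b, Fintype.card_fin, two_nsmul, two_mul]

theorem trace_eq_two_mul_leftMulMatrix_one (hb : Algebra.trace F E (b 1 / b 0) = 0) (z : E) :
    Algebra.trace F E z = 2 * Algebra.leftMulMatrix b z 1 1 := by
  have htrace := Algebra.trace_eq_matrix_trace b z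
  rw [Matrix.trace_fin_two] at htrace
  linear_combination 2 * htrace - trace_eq_two_mul_leftMulMatrix_zero hb z

theorem two_ne_zero_of_trace_div_eq_zero [Algebra.IsSeparable F E]
    (hb : Algebra.trace F E (b 1 / b 0) = 0) : (2 : F) ≠ 0 := by
  have := Module.Finite.of_basis b
  obtain ⟨z, hz⟩ := Algebra.trace_surjective F E 1
  exact left_ne_zero_of_mul_eq_one ((trace_eq_two_mul_leftMulMatrix_zero hb z).symm.trans hz)

theorem trace_torusHom_mul_diagOne [Algebra.IsSeparable F E]
    (hb : Algebra.trace F E (b 1 / b 0) = 0) (z : Eˣ) (a : Fˣ) :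
    Matrix.trace (torusHom b z * diagOne a).val = 2⁻¹ * (a + 1) * Algebra.trace F E (z : E) := by
  have hentries : Matrix.trace (torusHom b z * diagOne a).val =
      Algebra.leftMulMatrix b (z : E) 0 0 * a + Algebra.leftMulMatrix b (z : E) 1 1 := by
    simp [Matrix.trace_fin_two, Matrix.mul_apply, torusHom, diagOne]
  have htwo := two_ne_zero_of_trace_div_eq_zero hb
  rw [hentries]
  field_simp
  linear_combination -(a : F) * trace_eq_two_mul_leftMulMatrix_zero hb z -
    trace_eq_two_mul_leftMulMatrix_one hb z

theorem torusChar_torusEquiv (Φ : MulChar E ℂ) (z : Eˣ) :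
    (torusChar b Φ (torusEquiv b z) : ℂ) = Φ z := by
  simp [torusChar]

theorem twistedAverage_torus [Finite F] [Fintype Eˣ] (Φ : MulChar E ℂ)
    (f : GeneralLinearGroup (Fin 2) F → ℂ) (g : GeneralLinearGroup (Fin 2) F) :
    twistedAverage (torus b) (torusChar b Φ) f g =
      (Nat.card Eˣ : ℂ)⁻¹ * ∑ z : Eˣ, (Φ z)⁻¹ * f (torusHom b z * g) := by
  rw [twistedAverage, ← Nat.card_congr (torusEquiv b).toEquiv, ← finsum_eq_sum_of_fintype]
  congr 1
  refine (finsum_eq_of_bijective _ (torusEquiv b).bijective fun z => ?_).symm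
  rw [torusChar_torusEquiv]
  rfl

end TorusMatrices

section TorusAverages

variable {F E : Type*} [Field F] [Fintype F] [Field E] [Algebra F E]
  (b : Module.Basis (Fin 2) F E)

include b in
theorem card_units_of_basis : (Nat.card Eˣ : ℂ) = (Fintype.card F : ℂ) ^ 2 - 1 := by
  have := Module.Finite.of_basis b
  rw [Nat.card_units, Module.natCard_eq_pow_finrank (K := F), Module.finrank_eq_card_basis b,
    Fintype.card_fin, Nat.card_eq_fintype_card, Nat.cast_sub (Nat.one_le_pow _ _ Fintype.card_pos),
    Nat.cast_pow, Nat.cast_one]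

open scoped Classical in
theorem twistedAverage_torus_centralExtension_diagOne (Φ : MulChar E ℂ)
    (χ : Fˣ →* ℂˣ) (a : Fˣ) :
    twistedAverage (torus b) (torusChar b Φ) (centralExtension χ) (diagOne a) =
      ((Fintype.card F : ℂ) + 1)⁻¹ * (if a = 1 then 1 else 0) *
        (if χ = restrictToBase F Φ then 1 else 0) := by
  have := Module.Finite.of_basis b
  have : Finite E := Module.finite_of_finite F
  cases nonempty_fintype Eˣ
  rw [twistedAverage_torus, card_units_of_basis b]
  obtain rfl | ha := eq_or_ne a 1
  · have hcard : (Fintype.card Fˣ : ℂ) = Fintype.card F - 1 := by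
      rw [Fintype.card_units, Nat.cast_sub Fintype.card_pos, Nat.cast_one]
    have hindex : ((Fintype.card F : ℂ) ^ 2 - 1)⁻¹ * (Fintype.card F - 1) =
        ((Fintype.card F : ℂ) + 1)⁻¹ := by
      have hq : (Fintype.card F : ℂ) - 1 ≠ 0 :=
        sub_ne_zero.2 (Nat.cast_ne_one.2 Fintype.one_lt_card.ne')
      rw [← one_pow 2, sq_sub_sq, one_pow, mul_inv, inv_mul_cancel_right₀ hq]
    simp only [diagOne_one, mul_one, sum_inv_mul_centralExtension_torusHom, hcard, if_true]
    rw [mul_ite, hindex, mul_zero, mul_ite, mul_one, mul_zero]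
  · have hzero (z : Eˣ) : centralExtension χ (torusHom b z * diagOne a) = 0 :=
      centralExtension_of_notMem_center _ fun h =>
        ha ((torusHom_mul_diagOne_mem_center_iff b).1 h).1
    simp only [hzero, ha, mul_zero, zero_mul, if_false, Finset.sum_const_zero]

theorem twistedAverage_torus_normTraceSum_diagOne [Fintype E] {b}
    (hb : Algebra.trace F E (b 1 / b 0) = 0) (Φ Λ : MulChar E ℂ) (a : Fˣ) :
    twistedAverage (torus b) (torusChar b Φ)
      (fun g => normTraceSum Λ (GeneralLinearGroup.det g) (Matrix.trace g.val)) (diagOne a) =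
      -twistedSum Φ Λ a := by
  classical
  have hmem (z w : Eˣ) : (Units.map (Algebra.norm F) w = Units.map (Algebra.norm F) z * a ∧
      Algebra.trace F E (w : E) = 2⁻¹ * (a + 1) * Algebra.trace F E (z : E)) ↔
        (z, w) ∈ normTraceSet E a := by
    rw [mul_comm, Units.ext_iff]
    rfl
  rw [twistedAverage_torus, card_units_of_basis b, twistedSum, neg_mul, neg_neg]
  congr 1
  rw [finsum_mem_def, finsum_eq_sum_of_fintype, Fintype.sum_prod_type]
  simp only [map_mul, det_torusHom, det_diagOne, trace_torusHom_mul_diagOne hb, normTraceSum, hmem,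
    Finset.sum_filter, Finset.mul_sum, mul_ite, mul_zero, Set.indicator_apply]

end TorusAverages

end TwistedSpherical

open TwistedSpherical in
open Classical in
theorem mainTheorem3 {F E : Type*} [Field F] [Fintype F] [Field E] [Fintype E] [Algebra F E]
    (hF : ringChar F ≠ 2) (hE : Module.finrank F E = 2)
    (b : Module.Basis (Fin 2) F E) (hb : Algebra.trace F E (b 1 / b 0) = 0)
    (ψ : AddChar F ℂ) (hψ : ψ ≠ 1)
    (Φ Λ : MulChar E ℂ) (hΛ : Λ ^ Fintype.card F ≠ Λ) :
    (∀ (k k' : torus b) (g : Matrix.GeneralLinearGroup (Fin 2) F),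
      twistedSpherical hE b ψ hψ Φ Λ hΛ (k * g * k') =
        torusChar b Φ k * twistedSpherical hE b ψ hψ Φ Λ hΛ g * torusChar b Φ k') ∧
    ∀ a : Fˣ,
      twistedSpherical hE b ψ hψ Φ Λ hΛ (diagOne a) =
        twistedSum Φ Λ a +
          (Fintype.card F : ℂ) * ((Fintype.card F : ℂ) + 1)⁻¹ *
            (if a = 1 then 1 else 0) *
            (if restrictToBase F Λ = restrictToBase F Φ then 1 else 0) := by
  constructor
  · intro k k' g
    rw [twistedSpherical, twistedAverage_mul_right, twistedAverage_mul_left]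
    exact fun k g => Representation.char_mul_comm _ _ _
  · intro a
    have hcharacter := funext (character_cuspidalRep hE hψ hΛ)
    rw [twistedSpherical, hcharacter, twistedAverage_mul_sub,
      twistedAverage_torus_centralExtension_diagOne b,
      twistedAverage_torus_normTraceSum_diagOne hb]
    ring
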